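/- **Setting.** Let $m>0$ and let $M=\{(t^*,r,\omega)\in\mathbb R\times[m,\infty)\times\mathbb S^2\}$ be the extremal Reissner–Nordström exterior with metric $$g=-\Omega^2(dt^*)^2+2(1-\Omega^2)\,dt^*dr+(2-\Omega^2)\,dr^2+r^2d\omega^2,\qquad \Omega^2=\Big(1-\frac mr\Big)^2 .$$ Let $\mathcal H^+=\{r=m,\ t^*>0\}$ and, for a fixed $R>2m$, let $\tau=t^*$ for $r\le R$ and $\tau=u+c(R)$ for $r\ge R$, where $u=t-r^*$ with $t=t^*-F(r)$, $F(r)=2m\log(r-m)-\frac{m^2}{r-m}$, $r^*=r+F(r)-2m\log m-m$, and $c(R)=F(R)+r^*(R)$ makes $\tau$ continuous. Let $\mathcal P$ be the set of $(x,p)$ with $x\in M$ and $p\in T_xM$ a nonzero future-directed null vector (so $p^{t^*}>0$), $\mathcal P_x$ its fibre over $x$, and $\mathcal P_0=\mathcal P|_{\{\tau=0\}}$. Write $p=(p^{t^*},p^r,\cancel p)$ for the components in $(t^*,r,\omega)$-coordinates, $|\cancel p|_{\cancel g}$ for the length of $\cancel p$ in $\cancel g=r^2d\omega^2$, and let $$d\mu_x=\frac{r^2\sin\theta}{\Omega^2p^{t^*}-(1-\Omega^2)p^r}\,dp^r\,dp^\theta\,dp^\phi$$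 be the natural measure on $\mathcal P_x$. A function $f:\mathcal P\to[0,\infty)$ solves the massless Vlasov equation if it is conserved along the null geodesic flow. For $C_p>0$, $0<\mathcal C<1$ and $0<\delta<\frac12$ let $\mathfrak B_\delta=\mathfrak B_{\mathcal C,\delta}$ be the set of all $(x,p)\in\mathcal P_0$ with $$m\le r\le(1+\delta)m,\quad -\mathcal C C_p\sqrt{\Omega^2}\le p^r\le C_p\Omega^2,\quad |\cancel p|_{\cancel g}\le \mathcal C C_p(\Omega^2)^{1/4},\quad p^{t^*}\le\mathcal C C_p .$$ **Theorem.** There are dimensionless constants $\mathcal C\in(0,1)$ and $0<k\le K$, and for all real $a,b,c\ge0$ a dimensionless constant $C=C(a,b,c)>0$, such that for all $m>0$ and all $0<\delta<\frac12$ there is $\tau^\bullet$ with $k\,m\delta^{-1}\le\tau^\bullet\le K\,m\delta^{-1}$ and the following property. Let $R>2m$, $C_r,C_p>0$, let $f_0:\mathcal P_0\to[0,\infty)$ be continuous and bounded with $$\operatorname{supp} f_0\subset\{(x,p)\in\mathcal P_0:\ r\le C_r,\ p^{t^*},|p^r|,|\cancel p|_{\cancel g}\le C_p\},$$ and let $f$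 be a solution of the massless Vlasov equation with $f|_{\mathcal P_0}=f_0$. Then for all $x\in\mathcal H^+$ with $\tau(x)>\tau^\bullet$ $$\int_{\mathcal P_x}|p^r|^a\,|\cancel p|_{\cancel g}^b\,(p^{t^*})^c f\,d\mu_x\ \ge\ C\,C_p^{2+a+b+c}\,\frac{m^{2(a+1)+b}}{\tau(x)^{2(a+1)+b}}\ \inf_{(x',p')\in\mathfrak B_\delta}|f_0(x',p')| .$$ In particular, for $a=b=0$ the moment is bounded below along the horizon by a multiple of $\tau^{-2}$. -/

import Mathlib

open MeasureTheory Set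

noncomputable section

namespace ERN

/-!
The extremal Reissner-Nordstrom exterior `ℝ × [m, ∞) × S²` with coordinates `(t*, r, ω)` is
described through the single global chart `(t*, y) ∈ ℝ × ℝ³`, `y = r ω`, `r = ‖y‖ ≥ m`.
Tangent vectors are pairs `(p^{t*}, p^y) ∈ ℝ × ℝ³`.
-/

/-- Euclidean three-space. -/
abbrev Space : Type := EuclideanSpace ℝ (Fin 3)

/-- Points `(t*, r ω)`, and also the tangent vectors at such points. -/
abbrev Spacetime : Type := ℝ × Space

/-- The area radius `r`. -/
def radius (x : Spacetime) : ℝ := ‖x.2‖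

/-- `Ω² = 1 - 2m/r + q²/r²` with `q² = m²`, as a function of `r`. -/
def lapseSq (m r : ℝ) : ℝ := 1 - 2 * m / r + m ^ 2 / r ^ 2

/-- The one-form `dr` at the point `x`; applied to `p` it is the component `p^r`. -/
def dr (x v : Spacetime) : ℝ := inner ℝ x.2 v.2 / ‖x.2‖

/-- The spherical part `r² dω²` of the metric: the Euclidean product of the parts of the spatial
components that are orthogonal to the radial direction. -/
def sphereMetric (x v w : Spacetime) : ℝ := inner ℝ v.2 w.2 - dr x v * dr x w

/-- The metric
`g = -Ω² (dt*)² + 2 (1 - Ω²) dt* dr + (2 - Ω²) dr² + r² dω²`, as a bilinear form at `x`. -/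
def metric (m : ℝ) (x v w : Spacetime) : ℝ :=
  -lapseSq m (radius x) * (v.1 * w.1)
    + (1 - lapseSq m (radius x)) * (v.1 * dr x w + dr x v * w.1)
    + (2 - lapseSq m (radius x)) * (dr x v * dr x w)
    + sphereMetric x v w

/-- The directional derivative along `u`, at `x`, of `g(v, w)` for constant `v`, `w`. -/
def metricDeriv (m : ℝ) (x u v w : Spacetime) : ℝ :=
  fderiv ℝ (fun y => metric m y v w) x u

/-- The Christoffel symbols of the first kind in the chart,
`(∂_u g(v, w) + ∂_v g(u, w) - ∂_w g(u, v)) / 2 = g(Γ(u, v), w)`. -/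
def christoffel (m : ℝ) (x u v w : Spacetime) : ℝ :=
  (metricDeriv m x u v w + metricDeriv m x v u w - metricDeriv m x w u v) / 2

/-- The angular momentum component `|p̸|`, measured with `r² dω²`. -/
def angNorm (x p : Spacetime) : ℝ := Real.sqrt (sphereMetric x p p)

/-- The mass-shell: future-directed (nonzero) null vectors over the exterior `r ≥ m`. The
hypersurfaces of constant `t*` are spacelike, and a null vector is future-directed exactly when
`p^{t*} > 0`. -/
def massShell (m : ℝ) : Set (Spacetime × Spacetime) :=
  {z | m ≤ radius z.1 ∧ metric m z.1 z.2 z.2 = 0 ∧ 0 < z.2.1}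

/-- `γ`, with velocity `p`, is an affinely parametrised future-directed null geodesic of the
exterior on `[s₁, s₂]`. The geodesic equation `γ'' + Γ(γ', γ') = 0` is written with its index
lowered by the nondegenerate metric. -/
def IsNullGeodesic (m s₁ s₂ : ℝ) (γ p : ℝ → Spacetime) : Prop :=
  ∀ s ∈ Icc s₁ s₂,
    (γ s, p s) ∈ massShell m ∧
    HasDerivWithinAt γ (p s) (Icc s₁ s₂) s ∧
    ∃ acc : Spacetime, HasDerivWithinAt p acc (Icc s₁ s₂) s ∧
      ∀ v : Spacetime, metric m (γ s) acc v + christoffel m (γ s) (p s) (p s) v = 0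

/-- Solutions of the massless Vlasov equation: nonnegative functions on the mass-shell that are
conserved along the geodesic flow. Values outside the mass-shell are irrelevant. -/
def IsVlasovSolution (m : ℝ) (f : Spacetime × Spacetime → ℝ) : Prop :=
  (∀ z ∈ massShell m, 0 ≤ f z) ∧
  ∀ (s₁ s₂ : ℝ) (γ p : ℝ → Spacetime), s₁ ≤ s₂ → IsNullGeodesic m s₁ s₂ γ p →
    f (γ s₂, p s₂) = f (γ s₁, p s₁)

/-- The function `F` with `t* = t + F(r)`, a primitive of `(1 - Ω²) / Ω²`. -/
def tShift (m r : ℝ) : ℝ := 2 * m * Real.log (r - m) - m ^ 2 / (r - m)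

/-- The tortoise coordinate `r*`, with `dr*/dr = 1 / Ω²` and `r*(2m) = 0`. -/
def rStar (m r : ℝ) : ℝ :=
  r + 2 * m * Real.log (r - m) - m ^ 2 / (r - m) - 2 * m * Real.log m - m

/-- The time function: `t*` for `r ≤ R`, and `u + c(R)` with `u = t - r*` for `r ≥ R`, where
`c(R) = F(R) + r*(R)` makes it continuous. -/
def tau (m R : ℝ) (x : Spacetime) : ℝ :=
  if radius x ≤ R then x.1
  else x.1 - tShift m (radius x) - rStar m (radius x) + (tShift m R + rStar m R)

/-- The mass-shell over the initial hypersurface `{τ = 0}`. -/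
def initialShell (m R : ℝ) : Set (Spacetime × Spacetime) :=
  {z ∈ massShell m | tau m R z.1 = 0}

/-- The future event horizon `{r = m, t* > 0}`. -/
def horizon (m : ℝ) : Set Spacetime := {x | radius x = m ∧ 0 < x.1}

/-- Continuous bounded initial data on the initial mass-shell, whose support (relative to the
initial mass-shell) lies in `r ≤ C_r` and `p^{t*}, |p^r|, |p̸| ≤ C_p`. -/
structure IsInitialDatum (m R C_r C_p : ℝ) (f₀ : Spacetime × Spacetime → ℝ) : Prop where
  continuousOn : ContinuousOn f₀ (initialShell m R)
  bounded : ∃ B : ℝ, ∀ z ∈ initialShell m R, |f₀ z| ≤ B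
  support_subset : initialShell m R ∩ closure {z ∈ initialShell m R | f₀ z ≠ 0} ⊆
    {z | radius z.1 ≤ C_r ∧ z.2.1 ≤ C_p ∧ |dr z.1 z.2| ≤ C_p ∧ angNorm z.1 z.2 ≤ C_p}

/-- The set `𝔅_{𝒞,δ}` of "almost generators" of the horizon. The last condition bounds the momenta:
over `r = m` the other ones leave `p^{t*}` completely free. -/
def almostGenerators (m R C_p 𝒞 δ : ℝ) : Set (Spacetime × Spacetime) :=
  {z ∈ initialShell m R |
    radius z.1 ≤ (1 + δ) * m ∧
    -(𝒞 * C_p * Real.sqrt (lapseSq m (radius z.1))) ≤ dr z.1 z.2 ∧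
    dr z.1 z.2 ≤ C_p * lapseSq m (radius z.1) ∧
    angNorm z.1 z.2 ≤ 𝒞 * C_p * lapseSq m (radius z.1) ^ (1 / 4 : ℝ) ∧
    z.2.1 ≤ 𝒞 * C_p}

/-- The energy `E = Ω² p^{t*} - (1 - Ω²) p^r = -g(∂_{t*}, p)`. -/
def energy (m : ℝ) (x p : Spacetime) : ℝ :=
  lapseSq m (radius x) * p.1 - (1 - lapseSq m (radius x)) * dr x p

/-- The momentum `(p^{t*}, p^y)` over `x` with spatial part `p^y = q`, where `p^{t*}` is obtained by
solving the mass-shell relation. With `e = √((p^r)² + Ω² |p̸|²)`, it is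
`(e + (1 - Ω²) p^r) / Ω²`, and if `p^r ≤ 0` this is rewritten as `|p^r| + |p̸|² / (e + |p^r|)`,
which also makes sense on the horizon. -/
def lift (m : ℝ) (x : Spacetime) (q : Space) : Spacetime :=
  let pr := dr x (0, q)
  let pa := angNorm x (0, q)
  let e := Real.sqrt (pr ^ 2 + lapseSq m (radius x) * pa ^ 2)
  (if pr ≤ 0 then |pr| + pa ^ 2 / (e + |pr|) else (e + (1 - lapseSq m (radius x)) * pr) /
    lapseSq m (radius x), q)

/-- The moment `∫_{𝒫_x} w f dμ_x ∈ [0, ∞]` of a nonnegative `w f`. The fibre is parametrised by the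
spatial momentum `q = p^y ∈ ℝ³`. The measure
`dμ_x = (r² sin θ / E) dp^r dp^θ dp^φ` is `(1 / E) dq`, since `q` is the orthogonal sum of
`p^r` times the radial unit vector and of the angular part of `p`. Only those `q` count that are
spatial parts of elements of the fibre (up to the null set `p^r = 0` if `r = m`). -/
def moment (m : ℝ) (w f : Spacetime × Spacetime → ℝ) (x : Spacetime) : ENNReal :=
  ∫⁻ q in {q : Space | (x, lift m x q) ∈ massShell m},
    ENNReal.ofReal (w (x, lift m x q) * f (x, lift m x q) / energy m x (lift m x q))

/-- The weight `|p^r|^a |p̸|^b (p^{t*})^c`. -/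
def weight (a b c : ℝ) (z : Spacetime × Spacetime) : ℝ :=
  |dr z.1 z.2| ^ a * angNorm z.1 z.2 ^ b * z.2.1 ^ c

end ERN

end

noncomputable section

namespace ERN

/-! Light rays with little energy linger near the horizon. An ingoing null geodesic of energy E and
angular momentum L = mℓ has p^r = -√(E² - Ω²L²/r²). By extremality Ω² has a double zero at r = m, so
|p^r| stays comparable to E while r - m ≤ mE/(2ℓ). For E small against ℓ, p^{t*} is of size ℓ²/E
there, and crossing this region takes time of order mℓ/E. Put y = m/τ. If E/ℓ is of order y, the
geodesic that meets the horizon at time τ was at r - m of order my at time 0, where Ω is of order y.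
If ℓ is also at most a small multiple of C_p y, it started among the almost generators
(`exists_isNullGeodesic_from_almostGenerators`), and conservation of f carries the infimum of the
data to the horizon (`le_solution_on_horizon`). With τ^• = m/δ, late times are those with y < δ.

The momenta with ℓ of order C_p y and E of order C_p y² contain a box of volume of order Eℓ². The
density 1/E of the measure leaves ℓ², that is C_p² y². There |p^r|, |p̸|, p^{t*} have the orders C_p
y², C_p y, C_p, which gives C_p^{2+a+b+c} y^{2(a+1)+b} (`moment_lower_bound`).

The geodesics are explicit: each lies in a plane through the origin of the spatial chart, and
radius, time and angle are found by quadrature (`isNullGeodesic_plane`,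
`exists_isNullGeodesic_ingoing`). -/

/-! ### Kerr–Schild form of the metric and its Christoffel symbols. -/

/-- The flat metric plus a multiple of the square of the one-form dt* + dr. Only Ω² and dr depend on
the point, which keeps the derivatives short. -/
theorem metric_eq_kerrSchild (m : ℝ) (x v w : Spacetime) :
    metric m x v w = -(v.1 * w.1) + inner ℝ v.2 w.2
      + (1 - lapseSq m (radius x)) * ((v.1 + dr x v) * (w.1 + dr x w)) := by
  unfold metric sphereMetric
  ring

theorem hasDerivAt_lapseSq (m : ℝ) {r : ℝ} (hr : r ≠ 0) :
    HasDerivAt (lapseSq m) (2 * m / r ^ 2 - 2 * m ^ 2 / r ^ 3) r := by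
  unfold lapseSq
  have h1 := (hasDerivAt_const r (2 * m)).div (hasDerivAt_id r) hr
  have h2 := (hasDerivAt_const r (m ^ 2)).div (hasDerivAt_pow 2 r) (pow_ne_zero 2 hr)
  refine (((hasDerivAt_const r (1 : ℝ)).sub h1).add h2).congr_deriv ?_
  simp only [id]
  field_simp
  ring

theorem lapseSq_eq (m : ℝ) {r : ℝ} (hr : r ≠ 0) : lapseSq m r = ((r - m) / r) ^ 2 := by
  unfold lapseSq
  field_simp
  ring

theorem lapseSq_self {m : ℝ} (hm : m ≠ 0) : lapseSq m m = 0 := by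
  simp [lapseSq_eq m hm]

/-- The derivative of the radius along a straight line. -/
theorem hasDerivAt_radius_line {x u : Spacetime} (hx : x.2 ≠ 0) :
    HasDerivAt (fun h : ℝ => radius (x + h • u)) (dr x u) 0 := by
  have h0 : HasDerivAt (fun h : ℝ => x.2 + h • u.2) u.2 0 := by
    simpa using ((hasDerivAt_id (0 : ℝ)).smul_const u.2).const_add x.2
  have h1 := h0.norm_sq.sqrt (by simpa using hx)
  have hn : ‖x.2‖ ≠ 0 := norm_ne_zero_iff.mpr hx
  have h2 : HasDerivAt (fun h : ℝ => radius (x + h • u)) _ 0 :=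
    h1.congr_of_eventuallyEq (Filter.Eventually.of_forall fun h => by simp [radius])
  refine h2.congr_deriv ?_
  simp [dr]
  field_simp

/-- The derivative of the one-form `dr` along a straight line. -/
theorem hasDerivAt_dr_line {x u : Spacetime} (hx : x.2 ≠ 0) (v : Spacetime) :
    HasDerivAt (fun h : ℝ => dr (x + h • u) v) (sphereMetric x u v / radius x) 0 := by
  have h0 : HasDerivAt (fun h : ℝ => x.2 + h • u.2) u.2 0 := by
    simpa using ((hasDerivAt_id (0 : ℝ)).smul_const u.2).const_add x.2
  have hn : ‖x.2‖ ≠ 0 := norm_ne_zero_iff.mpr hx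
  have h1 := (h0.inner ℝ (hasDerivAt_const (0 : ℝ) v.2)).div (hasDerivAt_radius_line (u := u) hx)
    (by simpa [radius] using hx)
  refine h1.congr_deriv ?_
  simp [sphereMetric, radius, dr]
  field_simp

theorem metricDeriv_eq {m : ℝ} {x : Spacetime} (hx : x.2 ≠ 0) (u v w : Spacetime) :
    metricDeriv m x u v w =
      -(2 * m / radius x ^ 2 - 2 * m ^ 2 / radius x ^ 3) * dr x u
          * ((v.1 + dr x v) * (w.1 + dr x w))
        + (1 - lapseSq m (radius x)) / radius x
          * (sphereMetric x u v * (w.1 + dr x w) + (v.1 + dr x v) * sphereMetric x u w) := by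
  have hn : ‖x.2‖ ≠ 0 := norm_ne_zero_iff.mpr hx
  have hr : radius x ≠ 0 := hn
  have hd : DifferentiableAt ℝ (fun y => metric m y v w) x := by
    unfold metric sphereMetric lapseSq dr radius
    have h2 : DifferentiableAt ℝ (fun y : Spacetime => ‖y.2‖) x :=
      differentiableAt_snd.norm ℝ hx
    have h3 : ∀ z : Space, DifferentiableAt ℝ (fun y : Spacetime => inner ℝ y.2 z) x := fun z =>
      differentiableAt_snd.inner ℝ (differentiableAt_const z)
    have h4 := h3 v.2
    have h5 := h3 w.2
    fun_prop (disch := simp [hx])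
  have hl : HasDerivAt (fun h : ℝ => x + h • u) u 0 := by
    simpa using ((hasDerivAt_id (0 : ℝ)).smul_const u).const_add x
  have hd' : DifferentiableAt ℝ (fun y => metric m y v w) (x + (0 : ℝ) • u) := by simpa using hd
  have h1 := hd'.hasFDerivAt.comp_hasDerivAt (0 : ℝ) hl
  have hlap : HasDerivAt (lapseSq m) _ (radius (x + (0 : ℝ) • u)) :=
    hasDerivAt_lapseSq m (by simpa using hr)
  have h2 := (((hlap.comp (0 : ℝ) (hasDerivAt_radius_line (u := u) hx)).const_sub 1).mul
    (((hasDerivAt_dr_line (u := u) hx v).const_add v.1).mul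
      ((hasDerivAt_dr_line (u := u) hx w).const_add w.1))).const_add
        (-(v.1 * w.1) + inner ℝ v.2 w.2)
  have h3 : HasDerivAt (fun h : ℝ => metric m (x + h • u) v w) _ 0 :=
    h2.congr_of_eventuallyEq
      (Filter.Eventually.of_forall fun h => metric_eq_kerrSchild m (x + h • u) v w)
  have h4 := h1.unique h3
  simp only [zero_smul, add_zero, Function.comp] at h4
  unfold metricDeriv
  rw [h4]
  simp
  ring

theorem sphereMetric_comm (x v w : Spacetime) : sphereMetric x v w = sphereMetric x w v := by
  unfold sphereMetric
  rw [real_inner_comm]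
  ring

theorem christoffel_self_eq {m : ℝ} {x : Spacetime} (hx : x.2 ≠ 0) (p v : Spacetime) :
    christoffel m x p p v =
      -(2 * m / radius x ^ 2 - 2 * m ^ 2 / radius x ^ 3)
          * (dr x p * (p.1 + dr x p) * (v.1 + dr x v) - dr x v * (p.1 + dr x p) ^ 2 / 2)
        + (1 - lapseSq m (radius x)) / radius x * (sphereMetric x p p * (v.1 + dr x v)) := by
  unfold christoffel
  simp only [metricDeriv_eq hx, sphereMetric_comm x v p]
  ring

/-! ### Radial functions of ingoing null geodesics. -/

/-- `|p^r|` along a null geodesic of energy `E` and angular momentum `L`. -/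
def radialSpeed (m E L r : ℝ) : ℝ := Real.sqrt (E ^ 2 - lapseSq m r * (L / r) ^ 2)

/-- `p^{t*} + p^r` along an ingoing null geodesic of energy `E` and angular momentum `L`. -/
def ingoingPart (m E L r : ℝ) : ℝ := (L / r) ^ 2 / (E + radialSpeed m E L r)

/-- Rationalising E - √(E² - Ω²L²/r²) removes the division by Ω², so `ingoingPart` stays finite on
the horizon. -/
theorem lapseSq_mul_ingoingPart {m E L r : ℝ} (hE : 0 < E)
    (hV : 0 < E ^ 2 - lapseSq m r * (L / r) ^ 2) :
    lapseSq m r * ingoingPart m E L r = E - radialSpeed m E L r := by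
  have hs : radialSpeed m E L r ^ 2 = _ := Real.sq_sqrt hV.le
  have h0 : 0 ≤ radialSpeed m E L r := Real.sqrt_nonneg _
  have h1 : lapseSq m r * (L / r) ^ 2
      = (E - radialSpeed m E L r) * (E + radialSpeed m E L r) := by
    linear_combination hs
  unfold ingoingPart
  rw [← mul_div_assoc, h1, mul_div_assoc, div_self (by positivity), mul_one]

/-- This is the null condition; both the mass-shell relation and the geodesic equation reduce to it.
-/
theorem sq_angular_eq {m E L r : ℝ} (hE : 0 < E)
    (hV : 0 < E ^ 2 - lapseSq m r * (L / r) ^ 2) :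
    (L / r) ^ 2 = 2 * ingoingPart m E L r * radialSpeed m E L r
      + lapseSq m r * ingoingPart m E L r ^ 2 := by
  have h1 := lapseSq_mul_ingoingPart hE hV
  have h0 : 0 ≤ radialSpeed m E L r := Real.sqrt_nonneg _
  have h2 : ingoingPart m E L r * (E + radialSpeed m E L r) = (L / r) ^ 2 := by
    unfold ingoingPart
    field_simp
  linear_combination (-ingoingPart m E L r) * h1 - h2

theorem hasDerivAt_radialSpeed {m E L r : ℝ} (hr : r ≠ 0)
    (hV : 0 < E ^ 2 - lapseSq m r * (L / r) ^ 2) :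
    HasDerivAt (radialSpeed m E L)
      ((-(2 * m / r ^ 2 - 2 * m ^ 2 / r ^ 3) / 2 + lapseSq m r / r) * (L / r) ^ 2
        / radialSpeed m E L r) r := by
  have h1 := ((hasDerivAt_const r L).div (hasDerivAt_id r) hr).pow 2
  have h2 := (((hasDerivAt_lapseSq m hr).mul h1).const_sub (E ^ 2)).sqrt hV.ne'
  have h0 : 0 < radialSpeed m E L r := Real.sqrt_pos.mpr hV
  refine h2.congr_deriv ?_
  change _ / (2 * radialSpeed m E L r) = _
  simp
  field_simp
  ring

theorem hasDerivAt_ingoingPart {m E L r : ℝ} (hE : 0 < E) (hr : r ≠ 0)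
    (hV : 0 < E ^ 2 - lapseSq m r * (L / r) ^ 2) :
    HasDerivAt (ingoingPart m E L)
      ((-(2 * ingoingPart m E L r * radialSpeed m E L r) / r
        - (-(2 * m / r ^ 2 - 2 * m ^ 2 / r ^ 3) / 2 + lapseSq m r / r) * ingoingPart m E L r ^ 2)
        / radialSpeed m E L r) r := by
  have h1 := ((hasDerivAt_const r L).div (hasDerivAt_id r) hr).pow 2
  have h0 : 0 < radialSpeed m E L r := Real.sqrt_pos.mpr hV
  have h2 := h1.div ((hasDerivAt_radialSpeed hr hV).const_add E) (by positivity)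
  refine h2.congr_deriv ?_
  simp [ingoingPart]
  field_simp

/-! ### Planar null geodesics. -/

/-- The point at radius `r` and angle `φ` of the plane spanned by `n` and `e`, at time `t`. -/
def planePoint (n e : Space) (t r φ : ℝ) : Spacetime :=
  (t, r • (Real.cos φ • n + Real.sin φ • e))

/-- The momentum in the plane spanned by `n` and `e`, at radius `r` and angle `φ`, of the ingoing
null geodesic of energy `E` and angular momentum `L`. -/
def planeMomentum (m E L : ℝ) (n e : Space) (r φ : ℝ) : Spacetime :=
  (radialSpeed m E L r + ingoingPart m E L r,
    (-radialSpeed m E L r) • (Real.cos φ • n + Real.sin φ • e)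
      + (L / r) • (-Real.sin φ • n + Real.cos φ • e))


theorem norm_sq_rotated {n e : Space} (hn : ‖n‖ = 1) (he : ‖e‖ = 1) (hne : inner ℝ n e = 0)
    (φ : ℝ) : inner ℝ (Real.cos φ • n + Real.sin φ • e) (Real.cos φ • n + Real.sin φ • e) = 1 := by
  have hen : inner ℝ e n = 0 := by rw [real_inner_comm, hne]
  simp only [inner_add_left, inner_add_right, inner_smul_left, inner_smul_right, hne, hen,
    real_inner_self_eq_norm_sq, hn, he]
  simp
  nlinarith [Real.sin_sq_add_cos_sq φ]

theorem inner_rotated {n e : Space} (hn : ‖n‖ = 1) (he : ‖e‖ = 1) (hne : inner ℝ n e = 0)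
    (φ : ℝ) :
    inner ℝ (Real.cos φ • n + Real.sin φ • e) (-Real.sin φ • n + Real.cos φ • e) = 0 := by
  have hen : inner ℝ e n = 0 := by rw [real_inner_comm, hne]
  simp only [inner_add_left, inner_add_right, inner_smul_left, inner_smul_right, hne, hen,
    real_inner_self_eq_norm_sq, hn, he]
  simp
  ring

theorem norm_sq_rotated_perp {n e : Space} (hn : ‖n‖ = 1) (he : ‖e‖ = 1) (hne : inner ℝ n e = 0)
    (φ : ℝ) :
    inner ℝ (-Real.sin φ • n + Real.cos φ • e) (-Real.sin φ • n + Real.cos φ • e) = 1 := by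
  have hen : inner ℝ e n = 0 := by rw [real_inner_comm, hne]
  simp only [inner_add_left, inner_add_right, inner_smul_left, inner_smul_right, hne, hen,
    real_inner_self_eq_norm_sq, hn, he]
  simp
  nlinarith [Real.sin_sq_add_cos_sq φ]

theorem radius_planePoint {n e : Space} (hn : ‖n‖ = 1) (he : ‖e‖ = 1) (hne : inner ℝ n e = 0)
    (t φ : ℝ) {r : ℝ} (hr : 0 < r) : radius (planePoint n e t r φ) = r := by
  have h := norm_sq_rotated hn he hne φ
  rw [real_inner_self_eq_norm_sq, pow_eq_one_iff_of_nonneg (norm_nonneg _) two_ne_zero] at h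
  rw [radius, planePoint, norm_smul, h, mul_one, Real.norm_of_nonneg hr.le]

theorem dr_planePoint {n e : Space} (hn : ‖n‖ = 1) (he : ‖e‖ = 1) (hne : inner ℝ n e = 0)
    (t φ : ℝ) {r : ℝ} (hr : 0 < r) (v : Spacetime) :
    dr (planePoint n e t r φ) v = inner ℝ (Real.cos φ • n + Real.sin φ • e) v.2 := by
  have h : ‖(planePoint n e t r φ).2‖ = r := radius_planePoint hn he hne t φ hr
  unfold dr
  rw [h, planePoint, inner_smul_left]
  simp
  field_simp

theorem dr_planeMomentum {n e : Space} (hn : ‖n‖ = 1) (he : ‖e‖ = 1) (hne : inner ℝ n e = 0)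
    (m E L t φ : ℝ) {r : ℝ} (hr : 0 < r) :
    dr (planePoint n e t r φ) (planeMomentum m E L n e r φ) = -radialSpeed m E L r := by
  rw [dr_planePoint hn he hne t φ hr, planeMomentum, inner_add_right, inner_smul_right,
    inner_smul_right, norm_sq_rotated hn he hne, inner_rotated hn he hne]
  ring

theorem sphereMetric_planeMomentum {n e : Space} (hn : ‖n‖ = 1) (he : ‖e‖ = 1)
    (hne : inner ℝ n e = 0) (m E L t φ : ℝ) {r : ℝ} (hr : 0 < r) :
    sphereMetric (planePoint n e t r φ) (planeMomentum m E L n e r φ)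
      (planeMomentum m E L n e r φ) = (L / r) ^ 2 := by
  have h := inner_rotated hn he hne φ
  unfold sphereMetric
  rw [dr_planeMomentum hn he hne m E L t φ hr]
  unfold planeMomentum
  simp only [inner_add_left (𝕜 := ℝ) (_ • (_ + _)), inner_add_right (𝕜 := ℝ) _ (_ • (_ + _)),
    real_inner_smul_left _ (_ + _), real_inner_smul_right _ (_ + _), norm_sq_rotated hn he hne,
    norm_sq_rotated_perp hn he hne, h, real_inner_comm (Real.cos φ • n + Real.sin φ • e)]
  ring

theorem planeMomentum_mem_massShell {n e : Space} (hn : ‖n‖ = 1) (he : ‖e‖ = 1)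
    (hne : inner ℝ n e = 0) {m E L r : ℝ} (t φ : ℝ) (hm : 0 < m) (hE : 0 < E) (hr : m ≤ r)
    (hV : 0 < E ^ 2 - lapseSq m r * (L / r) ^ 2) :
    (planePoint n e t r φ, planeMomentum m E L n e r φ) ∈ massShell m := by
  have hr0 : 0 < r := hm.trans_le hr
  have hs : 0 < radialSpeed m E L r := Real.sqrt_pos.mpr hV
  refine ⟨(radius_planePoint hn he hne t φ hr0).symm ▸ hr, ?_, ?_⟩
  · have h1 := sphereMetric_planeMomentum hn he hne m E L t φ hr0
    have h2 := sq_angular_eq hE hV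
    unfold metric
    simp only [h1, radius_planePoint hn he hne t φ hr0, dr_planeMomentum hn he hne m E L t φ hr0]
    simp only [planeMomentum]
    linear_combination h2
  · have : 0 ≤ ingoingPart m E L r := by unfold ingoingPart; positivity
    simp only [planeMomentum]
    positivity

theorem hasDerivAt_planePoint {n e : Space} {m E L s : ℝ} {t ρ φ : ℝ → ℝ} (hr : ρ s ≠ 0)
    (ht : HasDerivAt t (radialSpeed m E L (ρ s) + ingoingPart m E L (ρ s)) s)
    (hρ : HasDerivAt ρ (-radialSpeed m E L (ρ s)) s) (hφ : HasDerivAt φ (L / ρ s ^ 2) s) :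
    HasDerivAt (fun s => planePoint n e (t s) (ρ s) (φ s))
      (planeMomentum m E L n e (ρ s) (φ s)) s := by
  refine (ht.prodMk (hρ.smul ((hφ.cos.smul_const n).add (hφ.sin.smul_const e)))).congr_deriv ?_
  unfold planeMomentum
  ext1
  · rfl
  · simp
    match_scalars <;> field_simp <;> ring

/-- The spatial acceleration is purely radial: r² φ' = L is constant, so the terms along the rotated
angular vector cancel. -/
theorem hasDerivAt_planeMomentum {n e : Space} {m E L s : ℝ} {ρ φ : ℝ → ℝ}
    (hE : 0 < E) (hr : ρ s ≠ 0) (hV : 0 < E ^ 2 - lapseSq m (ρ s) * (L / ρ s) ^ 2)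
    (hρ : HasDerivAt ρ (-radialSpeed m E L (ρ s)) s) (hφ : HasDerivAt φ (L / ρ s ^ 2) s) :
    HasDerivAt (fun s => planeMomentum m E L n e (ρ s) (φ s))
      (-((-(2 * m / ρ s ^ 2 - 2 * m ^ 2 / ρ s ^ 3) / 2 + lapseSq m (ρ s) / ρ s)
            * ((L / ρ s) ^ 2 - ingoingPart m E L (ρ s) ^ 2)
          - (2 * ingoingPart m E L (ρ s) * radialSpeed m E L (ρ s)) / ρ s),
        ((-(2 * m / ρ s ^ 2 - 2 * m ^ 2 / ρ s ^ 3) / 2 + lapseSq m (ρ s) / ρ s) * (L / ρ s) ^ 2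
          - (L / ρ s) ^ 2 / ρ s) • (Real.cos (φ s) • n + Real.sin (φ s) • e)) s := by
  have hs : 0 < radialSpeed m E L (ρ s) := Real.sqrt_pos.mpr hV
  have h1 := (hasDerivAt_radialSpeed hr hV).comp s hρ
  have h2 := (hasDerivAt_ingoingPart hE hr hV).comp s hρ
  have h3 := (hasDerivAt_const s L).div hρ hr
  have h4 := (hφ.cos.smul_const n).add (hφ.sin.smul_const e)
  have h5 := (hφ.sin.neg.smul_const n).add (hφ.cos.smul_const e)
  refine ((h1.add h2).prodMk ((h1.neg.smul h4).add (h3.smul h5))).congr_deriv ?_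
  ext1
  · simp
    field_simp
    ring
  · simp
    match_scalars <;> field_simp <;> ring

/-- Tested against v, the equation involves only v.1 and the radial part of v.2, and each of their
coefficients is a multiple of the null condition `sq_angular_eq`. -/
theorem geodesic_equation_plane {n e : Space} (hn : ‖n‖ = 1) (he : ‖e‖ = 1)
    (hne : inner ℝ n e = 0) {m E L r : ℝ} (t φ : ℝ) (hE : 0 < E) (hr : 0 < r)
    (hV : 0 < E ^ 2 - lapseSq m r * (L / r) ^ 2) (v : Spacetime) :
    metric m (planePoint n e t r φ)
      (-((-(2 * m / r ^ 2 - 2 * m ^ 2 / r ^ 3) / 2 + lapseSq m r / r)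
            * ((L / r) ^ 2 - ingoingPart m E L r ^ 2)
          - (2 * ingoingPart m E L r * radialSpeed m E L r) / r),
        ((-(2 * m / r ^ 2 - 2 * m ^ 2 / r ^ 3) / 2 + lapseSq m r / r) * (L / r) ^ 2
          - (L / r) ^ 2 / r) • (Real.cos φ • n + Real.sin φ • e)) v
      + christoffel m (planePoint n e t r φ) (planeMomentum m E L n e r φ)
        (planeMomentum m E L n e r φ) v = 0 := by
  have hrad := radius_planePoint hn he hne t φ hr
  have h0 : (planePoint n e t r φ).2 ≠ 0 := by
    rw [← norm_ne_zero_iff]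
    exact hrad.trans_ne hr.ne'
  rw [metric_eq_kerrSchild, christoffel_self_eq h0, dr_planeMomentum hn he hne m E L t φ hr,
    sphereMetric_planeMomentum hn he hne m E L t φ hr, hrad, dr_planePoint hn he hne t φ hr,
    dr_planePoint hn he hne t φ hr, real_inner_smul_left, real_inner_smul_right,
    norm_sq_rotated hn he hne]
  simp only [planeMomentum]
  generalize inner ℝ (Real.cos φ • n + Real.sin φ • e) v.2 = X
  have h2 := sq_angular_eq hE hV
  generalize 2 * m / r ^ 2 - 2 * m ^ 2 / r ^ 3 = a' at *
  generalize ingoingPart m E L r = κ at *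
  generalize radialSpeed m E L r = c at *
  generalize (L / r) ^ 2 = Λ at *
  generalize lapseSq m r = A at *
  linear_combination ((-a' / 2 + A / r) * v.1 + (-a' / 2 + A / r - 1 / r) * X) * h2

/-- Quadratures for `r`, `t*` and the angle give an ingoing null geodesic. -/
theorem isNullGeodesic_plane {n e : Space} (hn : ‖n‖ = 1) (he : ‖e‖ = 1) (hne : inner ℝ n e = 0)
    {m E L s₁ s₂ : ℝ} {t ρ φ : ℝ → ℝ} (hm : 0 < m) (hE : 0 < E)
    (hr : ∀ s ∈ Icc s₁ s₂, m ≤ ρ s)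
    (hV : ∀ s ∈ Icc s₁ s₂, 0 < E ^ 2 - lapseSq m (ρ s) * (L / ρ s) ^ 2)
    (ht : ∀ s ∈ Icc s₁ s₂,
      HasDerivAt t (radialSpeed m E L (ρ s) + ingoingPart m E L (ρ s)) s)
    (hρ : ∀ s ∈ Icc s₁ s₂, HasDerivAt ρ (-radialSpeed m E L (ρ s)) s)
    (hφ : ∀ s ∈ Icc s₁ s₂, HasDerivAt φ (L / ρ s ^ 2) s) :
    IsNullGeodesic m s₁ s₂ (fun s => planePoint n e (t s) (ρ s) (φ s))
      (fun s => planeMomentum m E L n e (ρ s) (φ s)) := by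
  intro s hs
  have hr0 : 0 < ρ s := hm.trans_le (hr s hs)
  exact ⟨planeMomentum_mem_massShell hn he hne _ _ hm hE (hr s hs) (hV s hs),
    (hasDerivAt_planePoint hr0.ne' (ht s hs) (hρ s hs) (hφ s hs)).hasDerivWithinAt, _,
    (hasDerivAt_planeMomentum hE hr0.ne' (hV s hs) (hρ s hs) (hφ s hs)).hasDerivWithinAt,
    geodesic_equation_plane hn he hne _ _ hE hr0 (hV s hs)⟩

/-! ### Existence of the geodesics by quadrature. -/

/-- The flow of a positive bounded vector field on the line, obtained by a quadrature. -/
theorem exists_integralCurve_of_pos {v : ℝ → ℝ} {B : ℝ} (hv : Continuous v) (hpos : ∀ r, 0 < v r)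
    (hB : ∀ r, v r ≤ B) (a : ℝ) :
    ∃ σ : ℝ → ℝ, StrictMono σ ∧ Function.Surjective σ ∧ σ 0 = a ∧
      ∀ s, HasDerivAt σ (v (σ s)) s := by
  have hB0 : 0 < B := (hpos 0).trans_le (hB 0)
  have hc : Continuous fun r => (v r)⁻¹ := hv.inv₀ fun r => (hpos r).ne'
  -- The travel time from a. Its slope is at least 1/B, so it maps onto ℝ, and its inverse is the
  -- integral curve.
  set S : ℝ → ℝ := fun r => ∫ x in a..r, (v x)⁻¹ with hS
  have hd : ∀ r, HasDerivAt S (v r)⁻¹ r := fun r =>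
    intervalIntegral.integral_hasDerivAt_right (hc.intervalIntegrable _ _)
      hc.stronglyMeasurable.stronglyMeasurableAtFilter hc.continuousAt
  have hScont : Continuous S := continuous_iff_continuousAt.mpr fun r => (hd r).continuousAt
  have hmono : StrictMono S := strictMono_of_deriv_pos fun r => by
    rw [(hd r).deriv]; exact inv_pos.mpr (hpos r)
  have hlow : Monotone fun r => S r - B⁻¹ * r := by
    have h : ∀ r, HasDerivAt (fun r => S r - B⁻¹ * r) ((v r)⁻¹ - B⁻¹) r := fun r =>
      ((hd r).sub ((hasDerivAt_id r).const_mul B⁻¹)).congr_deriv (by simp)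
    refine monotone_of_deriv_nonneg (fun r => (h r).differentiableAt) fun r => ?_
    rw [(h r).deriv, sub_nonneg]
    exact inv_anti₀ (hpos r) (hB r)
  have htop : Filter.Tendsto S Filter.atTop Filter.atTop := by
    have h : Filter.Tendsto (fun r : ℝ => B⁻¹ * r + (S 0 - B⁻¹ * 0)) Filter.atTop Filter.atTop :=
      Filter.tendsto_atTop_add_const_right _ _
        (Filter.tendsto_id.const_mul_atTop (inv_pos.mpr hB0))
    refine Filter.tendsto_atTop_mono' _ ?_ h
    filter_upwards [Filter.eventually_ge_atTop (0 : ℝ)] with r hr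
    have := hlow hr
    simp only at this
    linarith
  have hbot : Filter.Tendsto S Filter.atBot Filter.atBot := by
    have h : Filter.Tendsto (fun r : ℝ => B⁻¹ * r + (S 0 - B⁻¹ * 0)) Filter.atBot Filter.atBot :=
      Filter.tendsto_atBot_add_const_right _ _
        (Filter.tendsto_id.const_mul_atBot (inv_pos.mpr hB0))
    refine Filter.tendsto_atBot_mono' _ ?_ h
    filter_upwards [Filter.eventually_le_atBot (0 : ℝ)] with r hr
    have := hlow hr
    simp only at this
    linarith
  have hsurj := hScont.surjective htop hbot
  let Φ := hmono.orderIsoOfSurjective S hsurj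
  have hΦ : ∀ r, Φ r = S r := fun r => rfl
  have hS0 : S a = 0 := intervalIntegral.integral_same
  refine ⟨Φ.symm, Φ.symm.strictMono, Φ.symm.surjective, ?_, fun s => ?_⟩
  · rw [OrderIso.symm_apply_eq, hΦ, hS0]
  · have h1 : HasDerivAt S (v (Φ.symm s))⁻¹ (Φ.symm s) := hd _
    have h2 := h1.of_local_left_inverse (g := Φ.symm) Φ.symm.continuous.continuousAt
      (inv_ne_zero (hpos _).ne')
      (Filter.Eventually.of_forall fun y => by rw [← hΦ]; exact Φ.apply_symm_apply y)
    simpa using h2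

theorem lapseSq_nonneg (m : ℝ) {r : ℝ} (hr : r ≠ 0) : 0 ≤ lapseSq m r := by
  rw [lapseSq_eq m hr]
  positivity

theorem radialSpeed_le {m E L r : ℝ} (hE : 0 ≤ E) (hr : r ≠ 0) : radialSpeed m E L r ≤ E := by
  have := lapseSq_nonneg m hr
  refine Real.sqrt_le_iff.mpr ⟨hE, ?_⟩
  have : 0 ≤ lapseSq m r * (L / r) ^ 2 := by positivity
  linarith

theorem continuousOn_radialSpeed (m E L : ℝ) : ContinuousOn (radialSpeed m E L) (Ioi 0) := by
  unfold radialSpeed lapseSq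
  have h : ∀ x ∈ Ioi (0 : ℝ), x ≠ 0 := fun x hx => (mem_Ioi.mp hx).ne'
  have h2 : ∀ x ∈ Ioi (0 : ℝ), x ^ 2 ≠ 0 := fun x hx => pow_ne_zero 2 (h x hx)
  fun_prop (disch := assumption)

theorem continuousOn_ingoingPart (m L : ℝ) {E : ℝ} (hE : 0 < E) :
    ContinuousOn (ingoingPart m E L) (Ioi 0) := by
  have h : ∀ x ∈ Ioi (0 : ℝ), x ≠ 0 := fun x hx => (mem_Ioi.mp hx).ne'
  exact ((continuousOn_const.div continuousOn_id h).pow 2).div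
    (continuousOn_const.add (continuousOn_radialSpeed m E L)) fun x _ =>
      (add_pos_of_pos_of_nonneg hE (Real.sqrt_nonneg _)).ne'

/-- The null geodesic of energy `E` and angular momentum `L` that ends on the horizon at time `τ`,
followed backwards to time `0` while it is ingoing. -/
theorem exists_isNullGeodesic_ingoing {n e : Space} (hn : ‖n‖ = 1) (he : ‖e‖ = 1)
    (hne : inner ℝ n e = 0) {m E L r₁ τ : ℝ} (hm : 0 < m) (hE : 0 < E) (hr₁ : m ≤ r₁)
    (hV : ∀ r ∈ Icc m r₁, 0 < E ^ 2 - lapseSq m r * (L / r) ^ 2) (hτ : 0 ≤ τ)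
    (hT : τ ≤ ∫ r in m..r₁, (1 + ingoingPart m E L r / radialSpeed m E L r)) :
    ∃ r₀ ∈ Icc m r₁, ∫ r in m..r₀, (1 + ingoingPart m E L r / radialSpeed m E L r) = τ ∧
      ∃ (φ₀ s₁ : ℝ) (γ p : ℝ → Spacetime), s₁ ≤ 0 ∧ IsNullGeodesic m s₁ 0 γ p ∧
        γ 0 = planePoint n e τ m 0 ∧ p 0 = planeMomentum m E L n e m 0 ∧
        γ s₁ = planePoint n e 0 r₀ φ₀ ∧ p s₁ = planeMomentum m E L n e r₀ φ₀ := by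
  -- Clamping the radius to [m, r₁] gives a positive continuous field on the whole line; the orbit
  -- constructed below stays where the clamp is the identity.
  set c : ℝ → ℝ := fun r => max m (min r r₁) with hcdef
  have hc : Continuous c := by fun_prop
  have hcm : ∀ r, c r ∈ Icc m r₁ := fun r => ⟨le_max_left _ _, max_le hr₁ (min_le_right _ _)⟩
  have hc0 : ∀ r, 0 < c r := fun r => hm.trans_le (hcm r).1
  have hcid : ∀ r ∈ Icc m r₁, c r = r := fun r hr => by simp [hcdef, hr.1, hr.2]
  have hvc : Continuous fun r => radialSpeed m E L (c r) :=
    (continuousOn_radialSpeed m E L).comp_continuous hc hc0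
  have hic : Continuous fun r => ingoingPart m E L (c r) :=
    (continuousOn_ingoingPart m L hE).comp_continuous hc hc0
  have hv0 : ∀ r, 0 < radialSpeed m E L (c r) := fun r => Real.sqrt_pos.mpr (hV _ (hcm r))
  obtain ⟨σ, hσ, hσs, hσ0, hσd⟩ := exists_integralCurve_of_pos hvc hv0
    (fun r => radialSpeed_le hE.le (hc0 r).ne') m
  have hgc : Continuous fun r => 1 + ingoingPart m E L (c r) / radialSpeed m E L (c r) :=
    continuous_const.add (hic.div hvc fun r => (hv0 r).ne')
  have hac : Continuous fun r => L / (c r) ^ 2 / radialSpeed m E L (c r) :=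
    (continuous_const.div (hc.pow 2) fun r => pow_ne_zero 2 (hc0 r).ne').div hvc
      fun r => (hv0 r).ne'
  have hint : ∀ {f : ℝ → ℝ}, Continuous f → ∀ r, HasDerivAt (fun r => ∫ x in m..r, f x) (f r) r :=
    fun hf r => intervalIntegral.integral_hasDerivAt_right (hf.intervalIntegrable _ _)
      hf.stronglyMeasurable.stronglyMeasurableAtFilter hf.continuousAt
  have hTd := hint hgc
  have hΦd := hint hac
  have hTeq : ∀ r ∈ Icc m r₁,
      ∫ x in m..r, (1 + ingoingPart m E L (c x) / radialSpeed m E L (c x))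
        = ∫ x in m..r, (1 + ingoingPart m E L x / radialSpeed m E L x) := fun r hr =>
    intervalIntegral.integral_congr fun x hx => by
      rw [uIcc_of_le hr.1] at hx
      simp only [hcid x ⟨hx.1, hx.2.trans hr.2⟩]
  set T : ℝ → ℝ := fun r => ∫ x in m..r, (1 + ingoingPart m E L (c x) / radialSpeed m E L (c x))
  set Φ : ℝ → ℝ := fun r => ∫ x in m..r, L / (c x) ^ 2 / radialSpeed m E L (c x)
  have hTm : T m = 0 := intervalIntegral.integral_same
  have hΦm : Φ m = 0 := intervalIntegral.integral_same
  have hTc : Continuous T := continuous_iff_continuousAt.mpr fun r => (hTd r).continuousAt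
  -- The starting radius is the one whose travel time to the horizon is exactly τ.
  obtain ⟨r₀, hr₀, hTr₀⟩ := intermediate_value_Icc hr₁ hTc.continuousOn
    (show τ ∈ Icc (T m) (T r₁) from ⟨by rw [hTm]; exact hτ, hT.trans_eq (hTeq r₁ ⟨hr₁, le_rfl⟩).symm⟩)
  refine ⟨r₀, hr₀, (hTeq r₀ hr₀).symm.trans hTr₀, -Φ r₀, ?_⟩
  obtain ⟨s₀, hs₀⟩ := hσs r₀
  have hs₀0 : 0 ≤ s₀ := by
    rw [← hσ.le_iff_le, hσ0, hs₀]
    exact hr₀.1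
  have hρd : ∀ s, HasDerivAt (fun s => σ (-s)) (-radialSpeed m E L (c (σ (-s)))) s := fun s =>
    ((hσd (-s)).comp s (hasDerivAt_neg s)).congr_deriv (by simp)
  have hρm : ∀ s ∈ Icc (-s₀) 0, σ (-s) ∈ Icc m r₁ := fun s hs => by
    constructor
    · rw [← hσ0, hσ.le_iff_le]
      linarith [hs.2]
    · refine le_trans ?_ hr₀.2
      rw [← hs₀, hσ.le_iff_le]
      linarith [hs.1]
  refine ⟨-s₀, fun s => planePoint n e (τ - T (σ (-s))) (σ (-s)) (-Φ (σ (-s))),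
    fun s => planeMomentum m E L n e (σ (-s)) (-Φ (σ (-s))), by linarith, ?_, ?_, ?_, ?_, ?_⟩
  · refine isNullGeodesic_plane hn he hne hm hE (fun s hs => (hρm s hs).1)
      (fun s hs => hV _ (hρm s hs)) (fun s hs => ?_) (fun s hs => ?_) fun s hs => ?_
    · refine (((hTd _).comp s (hρd s)).const_sub τ).congr_deriv ?_
      have := hv0 (σ (-s))
      simp only [hcid _ (hρm s hs)] at this ⊢
      field_simp
    · have := hρd s
      rwa [hcid _ (hρm s hs)] at this
    · refine ((hΦd _).comp s (hρd s)).neg.congr_deriv ?_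
      have := hv0 (σ (-s))
      simp only [hcid _ (hρm s hs)] at this ⊢
      field_simp
  · simp [hσ0, hTm, hΦm]
  · simp [hσ0, hΦm]
  · simp [hs₀, hTr₀]
  · simp [hs₀]

/-! ### Estimates near the horizon. -/

theorem intervalIntegrable_time_integrand {m E L a b : ℝ} (hE : 0 < E) (ha : 0 < a) (hab : a ≤ b)
    (hV : ∀ r ∈ Icc a b, 0 < radialSpeed m E L r) :
    IntervalIntegrable (fun r => 1 + ingoingPart m E L r / radialSpeed m E L r) volume a b := by
  refine ContinuousOn.intervalIntegrable ?_
  rw [uIcc_of_le hab]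
  have hsub : Icc a b ⊆ Ioi 0 := fun r hr => ha.trans_le hr.1
  exact continuousOn_const.add (((continuousOn_ingoingPart m L hE).mono hsub).div
    ((continuousOn_radialSpeed m E L).mono hsub) fun r hr => (hV r hr).ne')

theorem sqrt_lapseSq {m r : ℝ} (hm : 0 < m) (hr : m ≤ r) :
    Real.sqrt (lapseSq m r) = (r - m) / r := by
  rw [lapseSq_eq m (hm.trans_le hr).ne']
  exact Real.sqrt_sq (div_nonneg (by linarith) (by linarith))

/-- The double zero of Ω² enters here: the potential is at most quadratic in r - m. -/
theorem sq_effective_potential_le {m ℓ r : ℝ} (hm : 0 < m) (hr : m ≤ r) :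
    lapseSq m r * (m * ℓ / r) ^ 2 ≤ ((r - m) * ℓ / m) ^ 2 := by
  have hr0 : 0 < r := hm.trans_le hr
  rw [lapseSq_eq m hr0.ne', ← mul_pow]
  have h : (r - m) / r * (m * ℓ / r) = (m / r) ^ 2 * ((r - m) * ℓ / m) := by field_simp
  rw [h, mul_pow]
  have h1 : ((m / r) ^ 2) ^ 2 ≤ 1 := by
    rw [← pow_mul]
    exact pow_le_one₀ (by positivity) ((div_le_one hr0).mpr hr)
  exact mul_le_of_le_one_left (sq_nonneg _) h1

/-- Well before the turning point, the radial speed is comparable to the energy. -/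
theorem radialSpeed_bounds {m E ℓ r : ℝ} (hm : 0 < m) (hE : 0 < E) (hℓ : 0 < ℓ)
    (hr : r ∈ Icc m (m + m * E / (2 * ℓ))) :
    0 < E ^ 2 - lapseSq m r * (m * ℓ / r) ^ 2 ∧ E / 2 ≤ radialSpeed m E (m * ℓ) r := by
  have h1 := sq_effective_potential_le (ℓ := ℓ) hm hr.1
  have h2 : (r - m) * ℓ / m ≤ E / 2 := by
    have : r - m ≤ m * E / (2 * ℓ) := by linarith [hr.2]
    rw [div_le_iff₀ hm]
    rw [le_div_iff₀ (by positivity)] at this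
    linarith
  have h3 : 0 ≤ (r - m) * ℓ / m := by
    have := hr.1
    have : 0 ≤ r - m := by linarith
    positivity
  have h4 : ((r - m) * ℓ / m) ^ 2 ≤ (E / 2) ^ 2 := pow_le_pow_left₀ h3 h2 2
  refine ⟨by nlinarith, Real.le_sqrt_of_sq_le ?_⟩
  nlinarith

theorem ingoingPart_bounds {m E ℓ r : ℝ} (hm : 0 < m) (hE : 0 < E) (hℓ : 0 < ℓ)
    (hr : r ∈ Icc m (3 / 2 * m)) :
    2 * ℓ ^ 2 / (9 * E) ≤ ingoingPart m E (m * ℓ) r ∧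
      ingoingPart m E (m * ℓ) r ≤ ℓ ^ 2 / E := by
  have hr0 : 0 < r := hm.trans_le hr.1
  have hs : radialSpeed m E (m * ℓ) r ≤ E := radialSpeed_le hE.le hr0.ne'
  have hs0 : 0 ≤ radialSpeed m E (m * ℓ) r := Real.sqrt_nonneg _
  have h1 : m * ℓ / r ≤ ℓ := by
    rw [div_le_iff₀ hr0]
    nlinarith [hr.1]
  have h2 : 2 / 3 * ℓ ≤ m * ℓ / r := by
    rw [le_div_iff₀ hr0]
    nlinarith [hr.2]
  have h3 : (m * ℓ / r) ^ 2 ≤ ℓ ^ 2 := pow_le_pow_left₀ (by positivity) h1 2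
  have h4 : (2 / 3 * ℓ) ^ 2 ≤ (m * ℓ / r) ^ 2 := pow_le_pow_left₀ (by positivity) h2 2
  unfold ingoingPart
  constructor
  · calc 2 * ℓ ^ 2 / (9 * E) = (2 / 3 * ℓ) ^ 2 / (2 * E) := by field_simp; ring
      _ ≤ _ := div_le_div₀ (sq_nonneg _) h4 (by positivity) (by linarith)
  · exact div_le_div₀ (sq_nonneg _) h3 hE (by linarith)

/-- The angular condition asks only for |p̸| ≲ C_p Ω^{1/2}; the stronger ℓ ≤ C_p Ω / 2 implies it
because Ω ≤ 1. With E ≤ ℓ it also bounds p^r from below, and p^r ≤ 0 settles the upper bound. -/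
theorem planePoint_mem_almostGenerators {n e : Space} (hn : ‖n‖ = 1) (he : ‖e‖ = 1)
    (hne : inner ℝ n e = 0) {m δ E ℓ R C_p r φ : ℝ} (hm : 0 < m) (hE : 0 < E) (hℓ : 0 < ℓ)
    (hCp : 0 < C_p) (hr : m ≤ r) (hrδ : r ≤ (1 + δ) * m) (hrR : r ≤ R)
    (hshell : (planePoint n e 0 r φ, planeMomentum m E (m * ℓ) n e r φ) ∈ massShell m)
    (hs : 0 ≤ radialSpeed m E (m * ℓ) r) (hΩ : ℓ ≤ 1 / 2 * C_p * ((r - m) / r)) (hEℓ : E ≤ ℓ)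
    (ht : radialSpeed m E (m * ℓ) r + ingoingPart m E (m * ℓ) r ≤ 1 / 2 * C_p) :
    (planePoint n e 0 r φ, planeMomentum m E (m * ℓ) n e r φ) ∈
      almostGenerators m R C_p (1 / 2) δ := by
  have hr0 : 0 < r := hm.trans_le hr
  have hrad := radius_planePoint hn he hne 0 φ hr0
  have hlap : lapseSq m r = ((r - m) / r) ^ 2 := lapseSq_eq m hr0.ne'
  have hΩ0 : 0 < (r - m) / r := pos_of_mul_pos_right (hℓ.trans_le hΩ) (by positivity)
  have hΩ1 : (r - m) / r ≤ 1 := by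
    rw [div_le_one hr0]
    linarith
  refine ⟨⟨hshell, ?_⟩, ?_, ?_, ?_, ?_, ht⟩
  · rw [tau, hrad, if_pos hrR]
    rfl
  · rwa [hrad]
  · rw [hrad, dr_planeMomentum hn he hne m E (m * ℓ) 0 φ hr0, sqrt_lapseSq hm hr]
    linarith [radialSpeed_le (m := m) (L := m * ℓ) hE.le hr0.ne']
  · rw [hrad, dr_planeMomentum hn he hne m E (m * ℓ) 0 φ hr0]
    have := lapseSq_nonneg m hr0.ne'
    exact le_trans (by linarith) (by positivity : 0 ≤ C_p * lapseSq m r)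
  · rw [hrad, angNorm, sphereMetric_planeMomentum hn he hne m E (m * ℓ) 0 φ hr0,
      Real.sqrt_sq (by positivity), hlap]
    have h1 : (r - m) / r ≤ (((r - m) / r) ^ 2) ^ (1 / 4 : ℝ) := by
      rw [← Real.rpow_natCast, ← Real.rpow_mul hΩ0.le]
      have := Real.rpow_le_rpow_of_exponent_ge hΩ0 hΩ1
        (show ((2 : ℕ) : ℝ) * (1 / 4) ≤ 1 by norm_num)
      rwa [Real.rpow_one] at this
    have h2 : m * ℓ / r ≤ ℓ := by
      rw [div_le_iff₀ hr0, mul_comm]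
      exact mul_le_mul_of_nonneg_left hr hℓ.le
    have h3 := mul_le_mul_of_nonneg_left h1 (by positivity : 0 ≤ 1 / 2 * C_p)
    linarith

/-- Null momenta on the horizon at time `τ` whose geodesics come from the almost generators. -/
theorem exists_isNullGeodesic_from_almostGenerators {n e : Space} (hn : ‖n‖ = 1) (he : ‖e‖ = 1)
    (hne : inner ℝ n e = 0) {m δ τ E ℓ R C_p : ℝ} (hm : 0 < m) (hδ : δ < 1 / 2)
    (hτ : m < δ * τ) (hτ0 : 0 < τ) (hR : 2 * m < R) (hCp : 0 < C_p) (hℓ : 0 < ℓ)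
    (hℓC : ℓ ≤ C_p / 4000 * (m / τ)) (hE₁ : ℓ * (m / τ) / 18 ≤ E) (hE₂ : E ≤ ℓ * (m / τ) / 9) :
    ∃ (s₁ : ℝ) (γ p : ℝ → Spacetime), s₁ ≤ 0 ∧ IsNullGeodesic m s₁ 0 γ p ∧
      γ 0 = planePoint n e τ m 0 ∧ p 0 = planeMomentum m E (m * ℓ) n e m 0 ∧
      (γ s₁, p s₁) ∈ almostGenerators m R C_p (1 / 2) δ := by
  obtain ⟨y, hy⟩ : ∃ y, y = m / τ := ⟨_, rfl⟩
  rw [← hy] at hℓC hE₁ hE₂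
  have hy0 : 0 < y := hy ▸ div_pos hm hτ0
  have hyδ : y < δ := by rw [hy, div_lt_iff₀ hτ0]; exact hτ
  have hτy : τ = m / y := by rw [hy]; field_simp
  have hE : 0 < E := lt_of_lt_of_le (by positivity) hE₁
  have hEℓ : E / ℓ ≤ y / 9 := by
    rw [div_le_iff₀ hℓ]; linarith
  obtain ⟨r₁, hr₁⟩ : ∃ r₁, r₁ = m + m * E / (2 * ℓ) := ⟨_, rfl⟩
  have hmr₁ : m ≤ r₁ := by
    rw [hr₁]
    exact le_add_of_nonneg_right (by positivity)
  have hr₁y : r₁ ≤ m * (1 + y / 18) := by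
    rw [hr₁, show m * E / (2 * ℓ) = m / 2 * (E / ℓ) by field_simp]
    nlinarith
  have hr₁m : r₁ ≤ 3 / 2 * m := by nlinarith
  have hsp : ∀ r ∈ Icc m r₁, _ := fun r hr =>
    radialSpeed_bounds (r := r) hm hE hℓ (by rwa [hr₁] at hr)
  have hip : ∀ r ∈ Icc m r₁, _ := fun r hr =>
    ingoingPart_bounds (r := r) hm hE hℓ ⟨hr.1, hr.2.trans hr₁m⟩
  have hsE : ∀ r ∈ Icc m r₁, radialSpeed m E (m * ℓ) r ≤ E := fun r hr =>
    radialSpeed_le hE.le (hm.trans_le hr.1).ne'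
  have hs0 : ∀ r ∈ Icc m r₁, 0 < radialSpeed m E (m * ℓ) r := fun r hr =>
    lt_of_lt_of_le (by positivity) (hsp r hr).2
  -- Travel time from r₁ is at least (r₁ - m) · 2ℓ²/(9E²) = mℓ/(9E), and E ≤ ℓy/9 makes this at
  -- least m/y = τ.
  have hTlow : τ ≤ ∫ r in m..r₁,
      (1 + ingoingPart m E (m * ℓ) r / radialSpeed m E (m * ℓ) r) := by
    have h1 : ∫ _r in m..r₁, 2 * ℓ ^ 2 / (9 * E) / E ≤ _ :=
      intervalIntegral.integral_mono_on hmr₁ intervalIntegrable_const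
        (intervalIntegrable_time_integrand (L := m * ℓ) hE hm hmr₁ hs0) fun r hr => by
          have h2 := div_le_div₀ (le_trans (by positivity) (hip r hr).1) (hip r hr).1 (hs0 r hr)
            (hsE r hr)
          linarith
    refine le_trans ?_ h1
    rw [intervalIntegral.integral_const, smul_eq_mul, hr₁, hτy]
    have h3 : (m + m * E / (2 * ℓ) - m) * (2 * ℓ ^ 2 / (9 * E) / E) = m * (ℓ / (9 * E)) := by
      field_simp
      ring
    rw [h3, div_eq_mul_inv]
    refine mul_le_mul_of_nonneg_left ?_ hm.le
    rw [le_div_iff₀ (by positivity), inv_mul_le_iff₀ hy0]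
    linarith
  obtain ⟨r₀, hr₀, hTr₀, φ₀, s₁, γ, p, hs₁, hgeo, hγ0, hp0, hγ1, hp1⟩ :=
    exists_isNullGeodesic_ingoing hn he hne hm hE hmr₁ (fun r hr => (hsp r hr).1) hτ0.le hTlow
  refine ⟨s₁, γ, p, hs₁, hgeo, hγ0, hp0, ?_⟩
  have hr₀0 : 0 < r₀ := hm.trans_le hr₀.1
  -- The integrand is at most 1 + 2ℓ²/E² ≤ 3ℓ²/E². A travel time of τ therefore keeps r₀ away from
  -- m.
  have hTup : τ ≤ (r₀ - m) * (3 * ℓ ^ 2 / E ^ 2) := by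
    rw [← hTr₀]
    refine le_of_le_of_eq (b := ∫ _r in m..r₀, 3 * ℓ ^ 2 / E ^ 2) ?_
      (by rw [intervalIntegral.integral_const, smul_eq_mul])
    refine intervalIntegral.integral_mono_on hr₀.1
      (intervalIntegrable_time_integrand (L := m * ℓ) hE hm hr₀.1
        fun r hr => hs0 r ⟨hr.1, hr.2.trans hr₀.2⟩) intervalIntegrable_const fun r hr => ?_
    have hr' : r ∈ Icc m r₁ := ⟨hr.1, hr.2.trans hr₀.2⟩
    have h2 := div_le_div₀ (by positivity) (hip r hr').2 (by positivity : 0 < E / 2) (hsp r hr').2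
    have h3 : 1 ≤ ℓ ^ 2 / E ^ 2 := by
      rw [one_le_div (by positivity)]
      refine pow_le_pow_left₀ hE.le ?_ 2
      nlinarith
    have h4 : ℓ ^ 2 / E / (E / 2) = 2 * (ℓ ^ 2 / E ^ 2) := by field_simp
    rw [h4] at h2
    have h5 : 3 * ℓ ^ 2 / E ^ 2 = 3 * (ℓ ^ 2 / E ^ 2) := by ring
    rw [h5]
    linarith
  have hr₀low : m * y / 972 ≤ r₀ - m := by
    have h1 : y ^ 2 / 324 ≤ E ^ 2 / ℓ ^ 2 := by
      rw [le_div_iff₀ (by positivity)]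
      have := pow_le_pow_left₀ (by positivity) hE₁ 2
      linarith [show (ℓ * y / 18) ^ 2 = y ^ 2 / 324 * ℓ ^ 2 by ring]
    have h2 : τ * (E ^ 2 / ℓ ^ 2) ≤ 3 * (r₀ - m) := by
      have := mul_le_mul_of_nonneg_right hTup (by positivity : 0 ≤ E ^ 2 / ℓ ^ 2)
      refine this.trans_eq ?_
      field_simp
    have h3 := mul_le_mul_of_nonneg_left h1 hτ0.le
    have h4 : τ * (y ^ 2 / 324) = m * y / 324 := by rw [hτy]; field_simp
    linarith
  -- 1458 = 972 · 3/2, from r₀ ≤ 3m/2. The factor 4000 in the bound on ℓ exceeds 2 · 1458, which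
  -- yields ℓ ≤ C_p Ω / 2.
  have hΩ : y / 1458 ≤ (r₀ - m) / r₀ := by
    rw [le_div_iff₀ hr₀0]
    have := hr₀.2
    nlinarith
  have hΩC : ℓ ≤ 1 / 2 * C_p * ((r₀ - m) / r₀) := by
    have := mul_le_mul_of_nonneg_left hΩ (by positivity : 0 ≤ 1 / 2 * C_p)
    linarith [mul_pos hCp hy0]
  have hℓy : ℓ * y ≤ ℓ := mul_le_of_le_one_right hℓ.le (by linarith)
  have hshell := (hgeo s₁ ⟨le_rfl, hs₁⟩).1
  have hmδ : m * (1 + y / 18) ≤ (1 + δ) * m := by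
    linarith [mul_lt_mul_of_pos_left hyδ hm, mul_pos hm hy0]
  rw [hγ1, hp1] at hshell ⊢
  refine planePoint_mem_almostGenerators hn he hne hm hE hℓ hCp hr₀.1
    (hr₀.2.trans (hr₁y.trans hmδ)) (by linarith [hr₀.2]) hshell (hs0 r₀ hr₀).le hΩC
    (by linarith) ?_
  -- E ≥ ℓy/18 keeps p^{t*} bounded by a multiple of C_p, although E itself is small.
  have h1 : ℓ ^ 2 / E ≤ 18 * (C_p / 4000) := by
    rw [div_le_iff₀ hE]
    have h2 := mul_le_mul_of_nonneg_left hℓC hℓ.le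
    have h3 := mul_le_mul_of_nonneg_left hE₁ hCp.le
    linarith
  have h2 : ℓ ≤ C_p / 4000 := hℓC.trans (mul_le_of_le_one_right (by positivity) (by linarith))
  have h3 := (hip r₀ hr₀).2
  have h4 := hsE r₀ hr₀
  linarith

/-! ### Integration over a box of momenta on the horizon. -/

/-- A box with respect to an orthonormal basis has the expected volume. -/
theorem volume_orthonormal_box (b : OrthonormalBasis (Fin 3) ℝ Space) (lo hi : Fin 3 → ℝ) :
    MeasurableSet {q : Space | ∀ i, b.repr q i ∈ Icc (lo i) (hi i)} ∧
      volume {q : Space | ∀ i, b.repr q i ∈ Icc (lo i) (hi i)}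
        = ∏ i, ENNReal.ofReal (hi i - lo i) := by
  have h := (PiLp.volume_preserving_ofLp (Fin 3)).comp b.measurePreserving_repr
  have hs : {q : Space | ∀ i, b.repr q i ∈ Icc (lo i) (hi i)}
      = (WithLp.ofLp ∘ b.repr) ⁻¹' Icc lo hi := by
    ext q
    simp only [mem_ofPred_eq, mem_preimage, mem_Icc, Pi.le_def, Function.comp, forall_and]
  rw [hs]
  exact ⟨h.measurable measurableSet_Icc, by
    rw [h.measure_preimage measurableSet_Icc.nullMeasurableSet, Real.volume_Icc_pi]⟩

theorem exists_orthonormalBasis_first {n : Space} (hn : ‖n‖ = 1) :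
    ∃ b : OrthonormalBasis (Fin 3) ℝ Space, b 0 = n := by
  have ho : Orthonormal ℝ (({0} : Set (Fin 3)).domRestrict fun _ => n) := by
    constructor
    · intro i
      simpa using hn
    · intro i j hij
      exact absurd (Subsingleton.elim i j) hij
  obtain ⟨b, hb⟩ := ho.exists_orthonormalBasis_extension_of_card_eq (by simp)
  exact ⟨b, hb 0 rfl⟩

theorem radialSpeed_horizon {m E : ℝ} (L : ℝ) (hm : m ≠ 0) (hE : 0 ≤ E) :
    radialSpeed m E L m = E := by
  simp [radialSpeed, lapseSq_self hm, Real.sqrt_sq hE]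

theorem ingoingPart_horizon {m E : ℝ} (ℓ : ℝ) (hm : m ≠ 0) (hE : 0 ≤ E) :
    ingoingPart m E (m * ℓ) m = ℓ ^ 2 / (2 * E) := by
  rw [ingoingPart, radialSpeed_horizon _ hm hE, mul_div_cancel_left₀ _ hm, two_mul]

/-- Over the horizon, `lift` gives the momentum of an ingoing null geodesic. -/
theorem lift_horizon {n e : Space} (hn : ‖n‖ = 1) (he : ‖e‖ = 1) (hne : inner ℝ n e = 0)
    {m E ℓ : ℝ} (τ : ℝ) (hm : 0 < m) (hE : 0 < E) :
    lift m (planePoint n e τ m 0) (-E • n + ℓ • e) = planeMomentum m E (m * ℓ) n e m 0 := by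
  have hdr : dr (planePoint n e τ m 0) (0, -E • n + ℓ • e) = -E := by
    rw [dr_planePoint hn he hne τ 0 hm]
    simp [inner_add_right, inner_smul_right, hn, hne]
  have hsp : sphereMetric (planePoint n e τ m 0) (0, -E • n + ℓ • e) (0, -E • n + ℓ • e)
      = ℓ ^ 2 := by
    have hen : inner ℝ e n = 0 := by rw [real_inner_comm, hne]
    rw [sphereMetric, hdr]
    simp only [inner_add_left, inner_add_right, real_inner_smul_left, inner_smul_right, hne, hen,
      real_inner_self_eq_norm_sq, hn, he]
    ring
  unfold lift angNorm
  simp only [hdr, hsp, radius_planePoint hn he hne τ 0 hm, lapseSq_self hm.ne']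
  rw [if_pos (by linarith), Real.sq_sqrt (sq_nonneg ℓ)]
  unfold planeMomentum
  rw [radialSpeed_horizon _ hm.ne' hE.le, ingoingPart_horizon ℓ hm.ne' hE.le,
    mul_div_cancel_left₀ _ hm.ne']
  have h1 : Real.sqrt ((-E) ^ 2 + 0 * ℓ ^ 2) = E := by
    rw [zero_mul, add_zero, neg_sq, Real.sqrt_sq hE.le]
  rw [h1, abs_neg, abs_of_pos hE, two_mul]
  simp

/-- Transport of a lower bound for the data along the almost generators of the horizon. -/
theorem le_solution_on_horizon {n e : Space} (hn : ‖n‖ = 1) (he : ‖e‖ = 1)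
    (hne : inner ℝ n e = 0) {m δ τ E ℓ R C_p : ℝ} {f₀ f : Spacetime × Spacetime → ℝ}
    (hm : 0 < m) (hδ : δ < 1 / 2) (hτ : m < δ * τ) (hτ0 : 0 < τ) (hR : 2 * m < R)
    (hCp : 0 < C_p) (hℓ : 0 < ℓ) (hℓC : ℓ ≤ C_p / 4000 * (m / τ))
    (hE₁ : ℓ * (m / τ) / 18 ≤ E) (hE₂ : E ≤ ℓ * (m / τ) / 9)
    (hf : IsVlasovSolution m f) (hff₀ : EqOn f f₀ (initialShell m R)) :
    (⨅ z : almostGenerators m R C_p (1 / 2) δ, |f₀ z|)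
      ≤ f (planePoint n e τ m 0, planeMomentum m E (m * ℓ) n e m 0) := by
  obtain ⟨s₁, γ, p, hs₁, hgeo, hγ0, hp0, hmem⟩ :=
    exists_isNullGeodesic_from_almostGenerators hn he hne hm hδ hτ hτ0 hR hCp hℓ hℓC hE₁ hE₂
  rw [← hγ0, ← hp0, hf.2 s₁ 0 γ p hs₁ hgeo, hff₀ hmem.1]
  have h0 : 0 ≤ f₀ (γ s₁, p s₁) := hff₀ hmem.1 ▸ hf.1 _ hmem.1.1
  rw [← abs_of_nonneg h0]
  exact ciInf_le (f := fun z : almostGenerators m R C_p (1 / 2) δ => |f₀ z|)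
    ⟨0, by rintro _ ⟨z, rfl⟩; exact abs_nonneg _⟩ ⟨_, hmem⟩

/-- The integrand of the moment on a box of momenta over the horizon. -/
theorem integrand_lower_bound {n e : Space} (hn : ‖n‖ = 1) (he : ‖e‖ = 1)
    (hne : inner ℝ n e = 0) {a b c m δ τ E ℓ l R C_p : ℝ} {f₀ f : Spacetime × Spacetime → ℝ}
    (ha : 0 ≤ a) (hb : 0 ≤ b) (hc : 0 ≤ c)
    (hm : 0 < m) (hδ : δ < 1 / 2) (hτ : m < δ * τ) (hτ0 : 0 < τ) (hR : 2 * m < R)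
    (hCp : 0 < C_p) (hl0 : 0 < l) (hl : 6 * l ≤ C_p / 4000 * (m / τ))
    (hℓ₁ : 4 * l ≤ ℓ) (hℓ₂ : ℓ ≤ 6 * l)
    (hE₁ : l * (m / τ) / 3 ≤ E) (hE₂ : E ≤ 4 * (l * (m / τ)) / 9)
    (hf : IsVlasovSolution m f) (hff₀ : EqOn f f₀ (initialShell m R)) :
    (planePoint n e τ m 0, lift m (planePoint n e τ m 0) (-E • n + ℓ • e)) ∈ massShell m ∧
    (l * (m / τ) / 3) ^ a * (4 * l) ^ b * (18 * (l / (m / τ))) ^ c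
        * (⨅ z : almostGenerators m R C_p (1 / 2) δ, |f₀ z|) / (4 * (l * (m / τ)) / 9) ≤
      weight a b c (planePoint n e τ m 0, lift m (planePoint n e τ m 0) (-E • n + ℓ • e))
        * f (planePoint n e τ m 0, lift m (planePoint n e τ m 0) (-E • n + ℓ • e))
        / energy m (planePoint n e τ m 0) (lift m (planePoint n e τ m 0) (-E • n + ℓ • e)) := by
  have hy : 0 < m / τ := div_pos hm hτ0
  have hE : 0 < E := lt_of_lt_of_le (by positivity) hE₁
  have hℓ : 0 < ℓ := by linarith
  rw [lift_horizon hn he hne τ hm hE]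
  have hV : 0 < E ^ 2 - lapseSq m m * (m * ℓ / m) ^ 2 := by
    rw [lapseSq_self hm.ne', zero_mul, sub_zero]
    positivity
  refine ⟨planeMomentum_mem_massShell hn he hne τ 0 hm hE le_rfl hV, ?_⟩
  -- The window ly/3 ≤ E ≤ 4ly/9, with y = m/τ, lies inside ℓy/18 ≤ E ≤ ℓy/9 for every ℓ in [4l,
  -- 6l].
  have h1 := mul_le_mul_of_nonneg_right hℓ₁ hy.le
  have h2 := mul_le_mul_of_nonneg_right hℓ₂ hy.le
  have hinf := le_solution_on_horizon (E := E) hn he hne hm hδ hτ hτ0 hR hCp hℓ (hℓ₂.trans hl)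
    (by linarith) (by linarith) hf hff₀
  have hdr : dr (planePoint n e τ m 0) (planeMomentum m E (m * ℓ) n e m 0) = -E := by
    rw [dr_planeMomentum hn he hne _ _ _ _ _ hm, radialSpeed_horizon _ hm.ne' hE.le]
  have hang : angNorm (planePoint n e τ m 0) (planeMomentum m E (m * ℓ) n e m 0) = ℓ := by
    rw [angNorm, sphereMetric_planeMomentum hn he hne _ _ _ _ _ hm,
      mul_div_cancel_left₀ _ hm.ne', Real.sqrt_sq hℓ.le]
  have hen : energy m (planePoint n e τ m 0) (planeMomentum m E (m * ℓ) n e m 0) = E := by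
    rw [energy, hdr, radius_planePoint hn he hne τ 0 hm, lapseSq_self hm.ne']
    ring
  have ht : 18 * (l / (m / τ)) ≤ (planeMomentum m E (m * ℓ) n e m 0).1 := by
    simp only [planeMomentum, radialSpeed_horizon _ hm.ne' hE.le,
      ingoingPart_horizon ℓ hm.ne' hE.le]
    have h3 : (4 * l) ^ 2 / (2 * (4 * (l * (m / τ)) / 9)) ≤ ℓ ^ 2 / (2 * E) :=
      div_le_div₀ (sq_nonneg _) (pow_le_pow_left₀ (by positivity) hℓ₁ 2) (by positivity)
        (by linarith)
    have h4 : (4 * l) ^ 2 / (2 * (4 * (l * (m / τ)) / 9)) = 18 * (l / (m / τ)) := by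
      field_simp
      norm_num
    linarith
  have hinf0 : 0 ≤ ⨅ z : almostGenerators m R C_p (1 / 2) δ, |f₀ z| :=
    Real.iInf_nonneg fun z => abs_nonneg _
  rw [weight, hen]
  simp only [hdr, hang, abs_neg, abs_of_pos hE]
  have hw : (l * (m / τ) / 3) ^ a * (4 * l) ^ b * (18 * (l / (m / τ))) ^ c
      ≤ E ^ a * ℓ ^ b * (planeMomentum m E (m * ℓ) n e m 0).1 ^ c := by
    gcongr
  have hp0 : 0 ≤ (planeMomentum m E (m * ℓ) n e m 0).1 := le_trans (by positivity) ht
  exact div_le_div₀ (mul_nonneg (by positivity) (hinf0.trans hinf))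
    (mul_le_mul hw hinf hinf0 (by positivity)) hE hE₂

/-- The box has volume (ly/9) · l · l with y = m/τ; dividing by the largest energy 4ly/9 leaves
l²/4. Its sides put the angular part between 4l and √26 l ≤ 6l. -/
theorem moment_lower_bound {a b c m δ l R C_p : ℝ} {f₀ f : Spacetime × Spacetime → ℝ}
    {x : Spacetime} (ha : 0 ≤ a) (hb : 0 ≤ b) (hc : 0 ≤ c)
    (hm : 0 < m) (hδ : δ < 1 / 2) (hx : radius x = m) (hτ : m < δ * x.1) (hτ0 : 0 < x.1)
    (hR : 2 * m < R) (hCp : 0 < C_p) (hl0 : 0 < l) (hl : 6 * l ≤ C_p / 4000 * (m / x.1))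
    (hf : IsVlasovSolution m f) (hff₀ : EqOn f f₀ (initialShell m R)) :
    ENNReal.ofReal ((l * (m / x.1) / 3) ^ a * (4 * l) ^ b * (18 * (l / (m / x.1))) ^ c
        * (⨅ z : almostGenerators m R C_p (1 / 2) δ, |f₀ z|) * (l ^ 2 / 4))
      ≤ moment m (weight a b c) f x := by
  have hy : 0 < m / x.1 := div_pos hm hτ0
  have hx2 : ‖x.2‖ = m := hx
  obtain ⟨n, hnx⟩ : ∃ n, n = m⁻¹ • x.2 := ⟨_, rfl⟩
  have hn : ‖n‖ = 1 := by
    rw [hnx, norm_smul, hx2, norm_inv, Real.norm_of_nonneg hm.le, inv_mul_cancel₀ hm.ne']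
  have hxn : x.2 = m • n := by rw [hnx, smul_inv_smul₀ hm.ne']
  obtain ⟨B, hB⟩ := exists_orthonormalBasis_first hn
  obtain ⟨hmeas, hvol⟩ := volume_orthonormal_box B
    ![-(4 * (l * (m / x.1)) / 9), 4 * l, 0] ![-(l * (m / x.1) / 3), 5 * l, l]
  set T := {q : Space | ∀ i, B.repr q i ∈
    Icc (![-(4 * (l * (m / x.1)) / 9), 4 * l, 0] i) (![-(l * (m / x.1) / 3), 5 * l, l] i)} with hTdef
  have hkey : ∀ q ∈ T, (x, lift m x q) ∈ massShell m ∧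
      (l * (m / x.1) / 3) ^ a * (4 * l) ^ b * (18 * (l / (m / x.1))) ^ c
        * (⨅ z : almostGenerators m R C_p (1 / 2) δ, |f₀ z|) / (4 * (l * (m / x.1)) / 9) ≤
      weight a b c (x, lift m x q) * f (x, lift m x q) / energy m x (lift m x q) := by
    intro q hq
    have h0 := hq 0
    have h1 := hq 1
    have h2 := hq 2
    simp only [Matrix.cons_val, Fin.isValue, mem_Icc] at h0 h1 h2
    have hqs : q = B.repr q 0 • n + (B.repr q 1 • B 1 + B.repr q 2 • B 2) := by
      conv_lhs => rw [← B.sum_repr q]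
      rw [Fin.sum_univ_three, hB, add_assoc]
    -- The angular part of q selects the plane of the geodesic: its second direction is w/‖w‖, with
    -- ℓ = ‖w‖ and E = -p^r.
    obtain ⟨w, hw⟩ : ∃ w, w = B.repr q 1 • B 1 + B.repr q 2 • B 2 := ⟨_, rfl⟩
    have hnw : inner ℝ n w = 0 := by
      rw [hw, ← hB, inner_add_right, inner_smul_right, inner_smul_right,
        B.inner_eq_zero (by decide), B.inner_eq_zero (by decide)]
      ring
    have hww : ‖w‖ ^ 2 = B.repr q 1 ^ 2 + B.repr q 2 ^ 2 := by
      rw [← real_inner_self_eq_norm_sq, hw]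
      simp only [inner_add_left, inner_add_right, real_inner_smul_left, inner_smul_right,
        B.inner_eq_one, B.inner_eq_zero (show (1 : Fin 3) ≠ 2 by decide),
        B.inner_eq_zero (show (2 : Fin 3) ≠ 1 by decide)]
      ring
    have hℓ₁ : 4 * l ≤ ‖w‖ := by
      refine le_of_sq_le_sq ?_ (norm_nonneg w)
      nlinarith
    have hℓ₂ : ‖w‖ ≤ 6 * l := by
      refine le_of_sq_le_sq ?_ (by positivity)
      nlinarith
    have hw0 : 0 < ‖w‖ := by linarith
    have he : ‖‖w‖⁻¹ • w‖ = 1 := by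
      rw [norm_smul, norm_inv, norm_norm, inv_mul_cancel₀ hw0.ne']
    have hne : inner ℝ n (‖w‖⁻¹ • w) = 0 := by rw [inner_smul_right, hnw, mul_zero]
    have hqE : q = -(-B.repr q 0) • n + ‖w‖ • ‖w‖⁻¹ • w := by
      rw [smul_inv_smul₀ hw0.ne', neg_neg, hw]
      exact hqs
    have hxp : x = planePoint n (‖w‖⁻¹ • w) x.1 m 0 := by
      unfold planePoint
      rw [Real.cos_zero, Real.sin_zero, one_smul, zero_smul, add_zero, ← hxn]
    have hfin := integrand_lower_bound (E := -B.repr q 0) hn he hne ha hb hc hm hδ hτ hτ0 hR hCp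
      hl0 hl hℓ₁ hℓ₂ (by linarith) (by linarith) hf hff₀
    rwa [← hqE, ← hxp] at hfin
  calc _ = ∫⁻ _q in T, ENNReal.ofReal ((l * (m / x.1) / 3) ^ a * (4 * l) ^ b
          * (18 * (l / (m / x.1))) ^ c
          * (⨅ z : almostGenerators m R C_p (1 / 2) δ, |f₀ z|) / (4 * (l * (m / x.1)) / 9)) := by
        rw [setLIntegral_const, hvol, Fin.prod_univ_three]
        simp only [Matrix.cons_val, Fin.isValue]
        have hinf0 : 0 ≤ ⨅ z : almostGenerators m R C_p (1 / 2) δ, |f₀ z| :=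
          Real.iInf_nonneg fun z => abs_nonneg _
        rw [← ENNReal.ofReal_mul (by linarith [mul_pos hl0 hy]),
          ← ENNReal.ofReal_mul (mul_nonneg (by linarith [mul_pos hl0 hy]) (by linarith)),
          ← ENNReal.ofReal_mul (by positivity)]
        congr 1
        field_simp
        ring
    _ ≤ ∫⁻ q in T, ENNReal.ofReal
          (weight a b c (x, lift m x q) * f (x, lift m x q) / energy m x (lift m x q)) :=
        setLIntegral_mono' hmeas fun q hq => ENNReal.ofReal_le_ofReal (hkey q hq).2
    _ ≤ moment m (weight a b c) f x := lintegral_mono_set fun q hq => (hkey q hq).1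

end ERN

end

/-! ### Choice of constants and counting of powers. -/

theorem theorem3p4 :
    ∃ 𝒞 k K : ℝ, 0 < 𝒞 ∧ 𝒞 < 1 ∧ 0 < k ∧ 0 < K ∧
      ∀ a b c : ℝ, 0 ≤ a → 0 ≤ b → 0 ≤ c →
      ∃ C : ℝ, 0 < C ∧
      ∀ m δ : ℝ, 0 < m → 0 < δ → δ < 1 / 2 →
      ∃ τb : ℝ, k * (m / δ) ≤ τb ∧ τb ≤ K * (m / δ) ∧
      ∀ R C_r C_p : ℝ, 2 * m < R → 0 < C_r → 0 < C_p →
      ∀ f₀ f : ERN.Spacetime × ERN.Spacetime → ℝ,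
        ERN.IsInitialDatum m R C_r C_p f₀ →
        ERN.IsVlasovSolution m f →
        Set.EqOn f f₀ (ERN.initialShell m R) →
        ∀ x ∈ ERN.horizon m, τb < ERN.tau m R x →
          ENNReal.ofReal
              (C * C_p ^ (2 + a + b + c) *
                (m ^ (2 * (a + 1) + b) / ERN.tau m R x ^ (2 * (a + 1) + b)) *
                ⨅ z : ERN.almostGenerators m R C_p 𝒞 δ, |f₀ z|)
            ≤ ERN.moment m (ERN.weight a b c) f x := by
  refine ⟨1 / 2, 1, 1, by norm_num, by norm_num, one_pos, one_pos, fun a b c ha hb hc =>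
    ⟨(1 / 72000) ^ a * (4 / 24000) ^ b * (18 / 24000) ^ c * ((1 / 24000) ^ 2 / 4), by positivity,
      fun m δ hm hδ0 hδ => ⟨m / δ, by simp, by simp, ?_⟩⟩⟩
  intro R C_r C_p hR _ hCp f₀ f _ hf hff₀ x hx hτ
  have htau : ERN.tau m R x = x.1 := if_pos (by rw [hx.1]; linarith)
  rw [htau] at hτ ⊢
  have hτ0 : 0 < x.1 := hx.2
  rw [div_lt_iff₀ hδ0, mul_comm] at hτ
  have hy : 0 < m / x.1 := div_pos hm hτ0
  -- l = C_p y / 24000 is the largest value allowed by 6l ≤ C_p y / 4000; what remains is an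
  -- identity of powers of C_p and y = m/τ.
  refine le_of_eq_of_le ?_ (ERN.moment_lower_bound (l := 1 / 24000 * (C_p * (m / x.1))) ha hb hc
    hm hδ hx.1 hτ hτ0 hR hCp (by positivity) (by linarith) hf hff₀)
  congr 1
  rw [← Real.div_rpow hm.le hτ0.le]
  generalize m / x.1 = y at hy
  have e1 : 1 / 24000 * (C_p * y) * y / 3 = 1 / 72000 * (C_p * y ^ 2) := by ring
  have e2 : 4 * (1 / 24000 * (C_p * y)) = 4 / 24000 * (C_p * y) := by ring
  have e3 : 18 * (1 / 24000 * (C_p * y) / y) = 18 / 24000 * C_p := by field_simp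
  have e4 : (C_p * y ^ 2) ^ a = C_p ^ a * y ^ (2 * a) := by
    rw [Real.mul_rpow hCp.le (by positivity), ← Real.rpow_natCast y 2, ← Real.rpow_mul hy.le,
      Nat.cast_ofNat]
  have e5 : C_p ^ (2 + a + b + c) = C_p ^ 2 * C_p ^ a * C_p ^ b * C_p ^ c := by
    rw [Real.rpow_add hCp, Real.rpow_add hCp, Real.rpow_add hCp, Real.rpow_two]
  have e6 : y ^ (2 * (a + 1) + b) = y ^ (2 * a) * y ^ 2 * y ^ b := by
    rw [Real.rpow_add hy, mul_add, mul_one, Real.rpow_add hy, Real.rpow_two]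
  rw [e1, e2, e3, Real.mul_rpow (by norm_num) (by positivity : 0 ≤ C_p * y ^ 2),
    Real.mul_rpow (by norm_num) (by positivity : 0 ≤ C_p * y), Real.mul_rpow (by norm_num) hCp.le,
    Real.mul_rpow hCp.le hy.le, e4, e5, e6]
  ring
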